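/- Fix $p\in(0,1)$. For $k\ge 1$ let $\{X_i^{(j)}\}_{1\le i\le k,\,j\ge 1}$ be i.i.d. random variables with $\mathrm P_p\{X_i^{(j)}=1\}=p=1-\mathrm P_p\{X_i^{(j)}=0\}$, and let $N_1,\dots,N_k$ be independent rate-one Poisson processes, independent of all the $X_i^{(j)}$. Write $J_i^{(j)}$ for the $j$-th jump time of $N_i$, with $J_i^{(0)}:=0$. The dynamical bit sequence is $$X_i(t):=\sum_{j=1}^\infty X_i^{(j)}\,\mathbf 1_{\{J_i^{(j-1)}\le t<J_i^{(j)}\}}\qquad(t\ge 0,\ 1\le i\le k),$$ and $S_k(t):=X_1(t)+\cdots+X_k(t)$. For $F\subset\mathbb R_+$ compact and $\varepsilon>0$ let $\mathrm K_F(\varepsilon)$, the Kolmogorov $\varepsilon$-capacity of $F$, be the largest integer $m\ge 1$ for which there exist $t_1,\dots,t_m\in F$ with $|t_i-t_j|\ge\varepsilon$ for all $i\ne j$ (and $\mathrm K_\varnothing(\varepsilon):=0$). **Theorem 1.1.** Let $\ell\ge 1$ be an integer and let $F\subset\mathbb R_+$ be a nonrandom compact set. Then, as $k\to\infty$, $$\mathrm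 P_p\{\exists\,t\in F:\ S_k(t)=k-\ell\}\asymp \mathrm K_F(1/k)\,k^\ell\,p^k;$$ that is, there are constants $0<c\le C<\infty$, depending only on $p$, $\ell$ and $F$, such that for all sufficiently large $k$, $$c\,\mathrm K_F(1/k)\,k^\ell p^k\le \mathrm P_p\{\exists\,t\in F:\ S_k(t)=k-\ell\}\le C\,\mathrm K_F(1/k)\,k^\ell p^k.$$ -/

import Mathlib

open MeasureTheory ProbabilityTheory Filter
open scoped NNReal

/-- The Kolmogorov `ε`-capacity (`ε`-packing number) of `F`: the largest integer `m ≥ 1` for which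
there are points `t₁, …, tₘ` of `F` at pairwise distance at least `ε`. -/
noncomputable def kolmogorovCapacity (F : Set ℝ≥0) (ε : ℝ) : ℕ :=
  sSup {m : ℕ | 1 ≤ m ∧ ∃ t : Fin m → ℝ≥0, (∀ i, t i ∈ F) ∧ ∀ i j, i ≠ j → ε ≤ dist (t i) (t j)}

/-- `N` is a rate-one Poisson process under `P`, as a counting process: almost surely it starts at
`0` and has nondecreasing right-continuous paths, and it has independent increments, the increment
over `[s, t]` having the Poisson distribution with mean `t - s`. -/
structure IsRateOnePoissonProcess {Ω : Type*} [MeasurableSpace Ω] (P : Measure Ω)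
    (N : ℝ≥0 → Ω → ℕ) : Prop where
  measurable : ∀ t, Measurable (N t)
  ae_zero : ∀ᵐ ω ∂P, N 0 ω = 0
  ae_monotone : ∀ᵐ ω ∂P, Monotone fun t => N t ω
  ae_rightContinuous : ∀ᵐ ω ∂P, ∀ t, ContinuousWithinAt (fun s => N s ω) (Set.Ici t) t
  indepIncrements : HasIndepIncrements N P
  increment_law : ∀ s t, s ≤ t → HasLaw (fun ω => N t ω - N s ω) (poissonMeasure (t - s)) P

/-- The `j`-th jump time `J^{(j)}` of a counting process, i.e. the first time at which the count
reaches `j`; in particular `J^{(0)} = 0`. -/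
noncomputable def jumpTime {Ω : Type*} (N : ℝ≥0 → Ω → ℕ) (j : ℕ) (ω : Ω) : ℝ≥0 :=
  sInf {t : ℝ≥0 | j ≤ N t ω}

/-- The ingredients of a dynamical bit sequence of length `k` with parameter `p`:
an i.i.d. array `ξ` of bits (`ξ i j` is the value of the `i`-th coordinate after `j` replacements),
each equal to `1` with probability `p` and to `0` with probability `1 - p`, and a family of `k`
independent rate-one Poisson processes which is independent of the array. -/
structure IsDynamicalBitData {Ω : Type*} [MeasurableSpace Ω] (P : Measure Ω) (p : ℝ) (k : ℕ)
    (ξ : Fin k → ℕ → Ω → ℕ) (N : Fin k → ℝ≥0 → Ω → ℕ) : Prop where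
  bit_measurable : ∀ i j, Measurable (ξ i j)
  bit_one : ∀ i j, P.real {ω | ξ i j ω = 1} = p
  bit_zero : ∀ i j, P.real {ω | ξ i j ω = 0} = 1 - p
  bits_indep : iIndepFun (fun (a : Fin k × ℕ) ω => ξ a.1 a.2 ω) P
  clock_poisson : ∀ i, IsRateOnePoissonProcess P (N i)
  clocks_indep : iIndepFun (fun (i : Fin k) (ω : Ω) (t : ℝ≥0) => N i t ω) P
  bits_clocks_indep : IndepFun (fun (ω : Ω) (a : Fin k × ℕ) => ξ a.1 a.2 ω)
    (fun (ω : Ω) (i : Fin k) (t : ℝ≥0) => N i t ω) P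

/-- The `i`-th coordinate of the dynamical bit sequence at time `t`,
`X_i(t) = ∑_{j ≥ 0} ξ_i^{(j)} 1{J_i^{(j)} ≤ t < J_i^{(j+1)}}`. -/
noncomputable def dynamicalBit {Ω : Type*} {k : ℕ} (ξ : Fin k → ℕ → Ω → ℕ)
    (N : Fin k → ℝ≥0 → Ω → ℕ) (i : Fin k) (t : ℝ≥0) (ω : Ω) : ℕ :=
  ∑' j : ℕ, ξ i j ω * Set.indicator (Set.Ico (jumpTime (N i) j ω) (jumpTime (N i) (j + 1) ω)) 1 t

/-- `S_k(t) = X_1(t) + ⋯ + X_k(t)`. -/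
noncomputable def dynamicalSum {Ω : Type*} {k : ℕ} (ξ : Fin k → ℕ → Ω → ℕ)
    (N : Fin k → ℝ≥0 → Ω → ℕ) (t : ℝ≥0) (ω : Ω) : ℕ :=
  ∑ i, dynamicalBit ξ N i t ω

/-! Almost surely `S_k(t)` is `onesCount`, the number of coordinates reading `1`, and the
coordinates are i.i.d. processes. Upper bound: a maximal `1/k`-packing is a net, so `F` is covered
by `K_F(1/k)` intervals of length at most `2/k`. If the count hits `k - ℓ` inside one of them, then
`k - ℓ` coordinates were `1` at its start or had their clock ring in it. Each does so with
probability at most `p + 2/k`, and a union bound over subsets gives order `k^ℓ p^k`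
(`measureReal_exists_mem_Icc_onesCount_eq_le`, `choose_mul_pow_le`). Lower bound: second moment over
the packing (`le_measureReal_iUnion_of_sum_inter_le`). Each event has probability at least of order
`k^ℓ p^k`. An exponential Markov bound with tilt `z = k^(-1/2)` gives joint probabilities at most of
order `k^ℓ p^k exp(-c k |s - t|)` (`measureReal_onesCount_inter_le`). Over `1/k`-separated points
this sums like a geometric series, so correlations cost only a constant. -/

/-! ### Independence and reading bits at random indices -/

theorem iIndepFun_of_uncurry {Ω ι κ E : Type*} [MeasurableSpace Ω] [MeasurableSpace E]
    {P : Measure Ω} {X : ι → κ → Ω → E} (mX : ∀ i j, Measurable (X i j))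
    (h : iIndepFun (fun (a : ι × κ) ω => X a.1 a.2 ω) P) :
    iIndepFun (fun i ω j => X i j ω) P := by
  have := h.isProbabilityMeasure
  have : ∀ i j, IsProbabilityMeasure (P.map (X i j)) :=
    fun i j => Measure.isProbabilityMeasure_map (mX i j).aemeasurable
  have hrow : ∀ i, iIndepFun (X i) P := fun i =>
    h.precomp (g := fun j => (i, j)) fun a b hab => (Prod.mk.inj hab).2
  rw [iIndepFun_iff_map_fun_eq_infinitePi_map (by fun_prop)]
  have hcurry : (fun ω i j => X i j ω)
      = MeasurableEquiv.curry ι κ E ∘ fun ω (a : ι × κ) => X a.1 a.2 ω := by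
    ext; rfl
  rw [hcurry, ← Measure.map_map (by fun_prop) (by fun_prop),
    (iIndepFun_iff_map_fun_eq_infinitePi_map (by fun_prop)).1 h,
    Measure.infinitePi_map_curry (fun i j => P.map (X i j))]
  congr with i : 1
  exact ((iIndepFun_iff_map_fun_eq_infinitePi_map (by fun_prop)).1 (hrow i)).symm

/-- Rectangles form a π-system generating the σ-algebra of each pair. On them the probability splits
into an `X`-part and a `Y`-part, each factors over `i`, and the factors regroup pairwise. -/
theorem iIndepFun_prodMk {Ω ι E E' : Type*} [MeasurableSpace Ω] [MeasurableSpace E]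
    [MeasurableSpace E'] {P : Measure Ω} {X : ι → Ω → E} {Y : ι → Ω → E'}
    (mX : ∀ i, Measurable (X i)) (mY : ∀ i, Measurable (Y i))
    (hX : iIndepFun X P) (hY : iIndepFun Y P)
    (hXY : IndepFun (fun ω i => X i ω) (fun ω i => Y i ω) P) :
    iIndepFun (fun i ω => (X i ω, Y i ω)) P := by
  classical
  let π : ι → Set (Set Ω) := fun i =>
    {s | ∃ A B, MeasurableSet A ∧ MeasurableSet B ∧ s = X i ⁻¹' A ∩ Y i ⁻¹' B}
  rw [iIndepFun_iff_iIndep]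
  refine iIndepSets.iIndep (fun i => ((mX i).prodMk (mY i)).comap_le) π ?_ ?_ ?_
  · rintro i _ ⟨A, B, hA, hB, rfl⟩ _ ⟨A', B', hA', hB', rfl⟩ -
    refine ⟨A ∩ A', B ∩ B', hA.inter hA', hB.inter hB', ?_⟩
    ext ω
    simp only [Set.mem_inter_iff, Set.mem_preimage]
    tauto
  · intro i
    rw [← generateFrom_prod, MeasurableSpace.comap_generateFrom]
    congr 1
    ext s
    constructor
    · rintro ⟨_, ⟨A, hA, B, hB, rfl⟩, rfl⟩
      exact ⟨A, B, hA, hB, rfl⟩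
    · rintro ⟨A, B, hA, hB, rfl⟩
      exact ⟨A ×ˢ B, ⟨A, hA, B, hB, rfl⟩, rfl⟩
  · rw [iIndepSets_iff]
    intro S f hf
    choose! A B hA hB hf using hf
    have hinter : ⋂ i ∈ S, f i = (fun ω i => X i ω) ⁻¹' (Set.pi S A)
        ∩ (fun ω i => Y i ω) ⁻¹' (Set.pi S B) := by
      ext ω
      simp only [Set.mem_iInter, Set.mem_inter_iff, Set.mem_preimage, Set.mem_pi,
        Finset.mem_coe]
      constructor
      · intro h
        have h' : ∀ i ∈ S, ω ∈ X i ⁻¹' A i ∩ Y i ⁻¹' B i := fun i hi => hf i hi ▸ h i hi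
        exact ⟨fun i hi => (h' i hi).1, fun i hi => (h' i hi).2⟩
      · intro h i hi
        rw [hf i hi]
        exact ⟨h.1 i hi, h.2 i hi⟩
    have hXinter : (fun ω i => X i ω) ⁻¹' (Set.pi S A) = ⋂ i ∈ S, X i ⁻¹' A i := by
      ext ω; simp [Set.mem_pi]
    have hYinter : (fun ω i => Y i ω) ⁻¹' (Set.pi S B) = ⋂ i ∈ S, Y i ⁻¹' B i := by
      ext ω; simp [Set.mem_pi]
    rw [hinter, hXY.measure_inter_preimage_eq_mul _ _
      (MeasurableSet.pi S.countable_toSet fun i hi => hA i hi)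
      (MeasurableSet.pi S.countable_toSet fun i hi => hB i hi), hXinter, hYinter,
      hX.measure_inter_preimage_eq_mul S hA, hY.measure_inter_preimage_eq_mul S hB,
      ← Finset.prod_mul_distrib]
    refine Finset.prod_congr rfl fun i hi => ?_
    have hXYi : IndepFun (X i) (Y i) P :=
      hXY.comp (measurable_pi_apply i) (measurable_pi_apply i)
    rw [hf i hi, hXYi.measure_inter_preimage_eq_mul _ _ (hA i hi) (hB i hi)]

/-- Two entries of an i.i.d. 0-1 sequence read at independent random places. -/
theorem measureReal_random_index_eq_one {Ω : Type*} [MeasurableSpace Ω] {P : Measure Ω}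
    [IsProbabilityMeasure P] {p : ℝ} {x : ℕ → Ω → ℕ} {A B : Ω → ℕ} (mx : ∀ j, Measurable (x j))
    (mA : Measurable A) (mB : Measurable B) (hx : ∀ j, P.real {ω | x j ω = 1} = p)
    (hind : iIndepFun x P) (hAB : IndepFun (fun ω j => x j ω) (fun ω => (A ω, B ω)) P) :
    P.real {ω | x (A ω) ω = 1 ∧ x (B ω) ω = 1}
      = p ^ 2 + p * (1 - p) * P.real {ω | A ω = B ω} := by
  have hset : MeasurableSet {a : (ℕ → ℕ) × (ℕ × ℕ) | a.1 a.2.1 = 1 ∧ a.1 a.2.2 = 1} := by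
    have h1 : Measurable fun a : (ℕ → ℕ) × (ℕ × ℕ) => a.1 a.2.1 :=
      measurable_from_prod_countable_left fun b => measurable_pi_apply b.1
    have h2 : Measurable fun a : (ℕ → ℕ) × (ℕ × ℕ) => a.1 a.2.2 :=
      measurable_from_prod_countable_left fun b => measurable_pi_apply b.2
    exact (h1 (measurableSet_singleton 1)).inter (h2 (measurableSet_singleton 1))
  have mxx : Measurable fun ω j => x j ω := by fun_prop
  have mAB : Measurable fun ω => (A ω, B ω) := by fun_prop
  have hmap := (indepFun_iff_map_prod_eq_prod_map_map mxx.aemeasurable mAB.aemeasurable).1 hAB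
  have : IsProbabilityMeasure (P.map fun ω j => x j ω) :=
    Measure.isProbabilityMeasure_map mxx.aemeasurable
  have hsec : ∀ m n : ℕ, P {ω | x m ω = 1 ∧ x n ω = 1}
      = if m = n then ENNReal.ofReal p else ENNReal.ofReal p ^ 2 := by
    have h1 : ∀ m, P {ω | x m ω = 1} = ENNReal.ofReal p := fun m => by
      rw [← hx m, ofReal_measureReal]
    intro m n
    split_ifs with hmn
    · subst hmn; simp [h1]
    · have := (hind.indepFun hmn).measure_inter_preimage_eq_mul {1} {1}
        (measurableSet_singleton _) (measurableSet_singleton _)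
      calc _ = P (x m ⁻¹' {1} ∩ x n ⁻¹' {1}) := rfl
        _ = _ := by
          rw [this]
          change P {ω | x m ω = 1} * P {ω | x n ω = 1} = _
          rw [h1, h1, sq]
  have mD : MeasurableSet {ω | A ω = B ω} := measurableSet_eq_fun mA mB
  have key : P {ω | x (A ω) ω = 1 ∧ x (B ω) ω = 1}
      = ENNReal.ofReal p * P {ω | A ω = B ω} + ENNReal.ofReal p ^ 2 * P {ω | A ω = B ω}ᶜ := by
    calc P {ω | x (A ω) ω = 1 ∧ x (B ω) ω = 1}
        = (P.map fun ω => ((fun j => x j ω), (A ω, B ω)))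
            {a | a.1 a.2.1 = 1 ∧ a.1 a.2.2 = 1} := by
          rw [Measure.map_apply (by fun_prop) hset]; rfl
      -- Fubini: the indices are frozen, then two fixed bits are read, coinciding exactly when `A ω
      -- = B ω`.
      _ = ∫⁻ ω, P {ω' | x (A ω) ω' = 1 ∧ x (B ω) ω' = 1} ∂P := by
          rw [hmap, Measure.prod_apply_symm hset, lintegral_map (measurable_of_countable _) mAB]
          refine lintegral_congr fun ω => ?_
          rw [Measure.map_apply mxx (measurable_prodMk_right hset)]
          rfl
      _ = ∫⁻ ω, {ω | A ω = B ω}.indicator (fun _ => ENNReal.ofReal p) ω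
            + {ω | A ω = B ω}ᶜ.indicator (fun _ => ENNReal.ofReal p ^ 2) ω ∂P := by
          refine lintegral_congr fun ω => ?_
          rw [hsec]
          by_cases h : A ω = B ω <;> simp [h]
      _ = _ := by
          rw [lintegral_add_left (measurable_const.indicator mD),
            lintegral_indicator_const mD, lintegral_indicator_const mD.compl]
  have hp : 0 ≤ p := hx 0 ▸ measureReal_nonneg
  rw [measureReal_def, key, ENNReal.toReal_add (by finiteness) (by finiteness),
    ENNReal.toReal_mul, ENNReal.toReal_mul, ENNReal.toReal_pow, ENNReal.toReal_ofReal hp,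
    ← measureReal_def, ← measureReal_def, measureReal_compl mD]
  simp only [probReal_univ]
  ring

/-! ### Poisson clocks and their jump times -/

namespace IsRateOnePoissonProcess

variable {Ω : Type*} [MeasurableSpace Ω] {P : Measure Ω}
  {N : ℝ≥0 → Ω → ℕ}

theorem measureReal_eq_eq_exp (hN : IsRateOnePoissonProcess P N) {s t : ℝ≥0} (hst : s ≤ t) :
    P.real {ω | N s ω = N t ω} = Real.exp (-((t : ℝ) - s)) := by
  -- Subtraction in `ℕ` is truncated: a zero increment means equality only on monotone paths.
  have h : {ω | N s ω = N t ω} =ᵐ[P] {ω | N t ω - N s ω ∈ ({0} : Set ℕ)} := by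
    filter_upwards [hN.ae_monotone] with ω hω
    have := hω hst
    simp only [eq_iff_iff]
    change N s ω = N t ω ↔ N t ω - N s ω = 0
    simp only at this
    omega
  rw [measureReal_congr h,
    (hN.increment_law s t hst).measureReal_eq (p := fun n => n ∈ ({0} : Set ℕ))
      (measurableSet_singleton 0)]
  change (poissonMeasure (t - s)).real {0} = _
  rw [poissonMeasure_real_singleton]
  simp [NNReal.coe_sub hst]

/-- Rules out the default `sInf ∅ = 0` in `jumpTime`. The probability of `N n < j` is a finite sum
of Poisson weights, each tending to `0`. -/
theorem ae_exists_le [IsProbabilityMeasure P] (hN : IsRateOnePoissonProcess P N) : ∀ᵐ ω ∂P, ∀ j, ∃ t, j ≤ N t ω := by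
  rw [ae_all_iff]
  intro j
  have hlaw : ∀ n : ℕ, P.real {ω | N n ω < j}
      = ∑ i ∈ Finset.range j, Real.exp (-(n : ℝ)) * (n : ℝ) ^ i / (i.factorial : ℝ) := by
    intro n
    have h : {ω | N n ω < j} =ᵐ[P] {ω | N n ω - N 0 ω ∈ (Finset.range j : Set ℕ)} := by
      filter_upwards [hN.ae_zero] with ω hω
      simp only [eq_iff_iff]
      change N n ω < j ↔ N n ω - N 0 ω ∈ (Finset.range j : Set ℕ)
      simp [hω]
    rw [measureReal_congr h,
      (hN.increment_law 0 n zero_le).measureReal_eq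
        (p := fun n => n ∈ (Finset.range j : Set ℕ)) MeasurableSet.of_discrete]
    change (poissonMeasure (n - 0)).real (Finset.range j : Set ℕ) = _
    rw [← sum_measureReal_singleton]
    simp [poissonMeasure_real_singleton]
  have hlim : Tendsto (fun n : ℕ => P.real {ω | N n ω < j}) atTop (nhds 0) := by
    simp_rw [hlaw]
    rw [← Finset.sum_const_zero (s := Finset.range j)]
    refine tendsto_finsetSum _ fun i _ => ?_
    have := ((Real.tendsto_pow_mul_exp_neg_atTop_nhds_zero i).comp
      tendsto_natCast_atTop_atTop).div_const (i.factorial : ℝ)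
    rw [zero_div] at this
    refine this.congr fun n => ?_
    simp [mul_comm]
  rw [ae_iff, ← measureReal_eq_zero_iff]
  refine le_antisymm (ge_of_tendsto' hlim fun n => measureReal_mono ?_) measureReal_nonneg
  intro ω hω
  simp only [Set.mem_ofPred_eq, not_exists, not_le] at hω ⊢
  exact hω n

/-- The infimum is attained: a right-continuous integer path is constant just to the right of it,
where the set has points. -/
theorem ae_jumpTime_le_iff [IsProbabilityMeasure P] (hN : IsRateOnePoissonProcess P N) :
    ∀ᵐ ω ∂P, ∀ j t, jumpTime N j ω ≤ t ↔ j ≤ N t ω := by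
  filter_upwards [hN.ae_monotone, hN.ae_rightContinuous, hN.ae_exists_le] with ω hmono hcont hex j t
  refine ⟨fun h => ?_, fun h => csInf_le (OrderBot.bddBelow _) h⟩
  refine le_trans ?_ (hmono h)
  have hev : ∀ᶠ s in nhdsWithin (jumpTime N j ω) (Set.Ici (jumpTime N j ω)),
      N s ω = N (jumpTime N j ω) ω := by
    have := hcont (jumpTime N j ω)
    rw [ContinuousWithinAt, nhds_discrete, tendsto_pure] at this
    exact this
  obtain ⟨u, hu, hu'⟩ := (mem_nhdsGE_iff_exists_Ico_subset).1 hev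
  obtain ⟨s, hs, hsu⟩ := exists_lt_of_csInf_lt (s := {t : ℝ≥0 | j ≤ N t ω}) (hex j) hu
  have hle : jumpTime N j ω ≤ s := csInf_le (OrderBot.bddBelow _) hs
  have : N s ω = N (jumpTime N j ω) ω := hu' ⟨hle, hsu⟩
  change j ≤ N (jumpTime N j ω) ω
  rw [← this]
  exact hs

end IsRateOnePoissonProcess

/-! ### Law of one coordinate and independence between coordinates -/

namespace IsDynamicalBitData

variable {Ω : Type*} [MeasurableSpace Ω] {P : Measure Ω} {p : ℝ} {k : ℕ}
  {ξ : Fin k → ℕ → Ω → ℕ} {N : Fin k → ℝ≥0 → Ω → ℕ}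

/-- Only the index `j = N i t ω` has an interval containing `t`, so each series has one surviving
term. -/
theorem ae_dynamicalSum_eq [IsProbabilityMeasure P] (h : IsDynamicalBitData P p k ξ N) :
    ∀ᵐ ω ∂P, ∀ t, dynamicalSum ξ N t ω = ∑ i, ξ i (N i t ω) ω := by
  have h' : ∀ᵐ ω ∂P, ∀ i j t, jumpTime (N i) j ω ≤ t ↔ j ≤ N i t ω :=
    ae_all_iff.2 fun i => (h.clock_poisson i).ae_jumpTime_le_iff
  filter_upwards [h'] with ω hω t
  refine Finset.sum_congr rfl fun i _ => ?_
  rw [dynamicalBit, tsum_eq_single (N i t ω)]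
  · rw [Set.indicator_of_mem, Pi.one_apply, mul_one]
    rw [Set.mem_Ico, hω, ← not_le, hω]
    omega
  · intro j hj
    rw [Set.indicator_of_notMem, mul_zero]
    rw [Set.mem_Ico, hω, ← not_le, hω]
    omega

theorem ae_bit_eq_zero_or_one [IsProbabilityMeasure P] (h : IsDynamicalBitData P p k ξ N) :
    ∀ᵐ ω ∂P, ∀ i j, ξ i j ω = 0 ∨ ξ i j ω = 1 := by
  simp only [ae_all_iff]
  intro i j
  have m0 : MeasurableSet {ω | ξ i j ω = 0} := h.bit_measurable i j (measurableSet_singleton 0)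
  have m1 : MeasurableSet {ω | ξ i j ω = 1} := h.bit_measurable i j (measurableSet_singleton 1)
  have hunion : P.real ({ω | ξ i j ω = 0} ∪ {ω | ξ i j ω = 1}) = 1 := by
    rw [measureReal_union _ m1, h.bit_one, h.bit_zero]
    · ring
    · rw [Set.disjoint_left]
      intro ω h0 h1
      simp_all
  have hcompl := measureReal_compl (μ := P) (m0.union m1)
  rw [hunion, probReal_univ, sub_self, measureReal_eq_zero_iff] at hcompl
  exact hcompl

theorem iIndepFun_coordinates (h : IsDynamicalBitData P p k ξ N) :
    iIndepFun (fun i ω => ((fun j => ξ i j ω), fun t => N i t ω)) P := by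
  have hN := fun i => (h.clock_poisson i).measurable
  have hξ := h.bit_measurable
  refine iIndepFun_prodMk (by fun_prop) (by fun_prop)
    (iIndepFun_of_uncurry hξ h.bits_indep) h.clocks_indep ?_
  exact h.bits_clocks_indep.comp
    (φ := fun (f : Fin k × ℕ → ℕ) i j => f (i, j)) (ψ := id) (by fun_prop) measurable_id

theorem indepFun_coordinate (h : IsDynamicalBitData P p k ξ N) (i : Fin k) :
    IndepFun (fun ω j => ξ i j ω) (fun ω t => N i t ω) P :=
  h.bits_clocks_indep.comp (φ := fun (f : Fin k × ℕ → ℕ) j => f (i, j))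
    (ψ := fun (f : Fin k → ℝ≥0 → ℕ) => f i) (by fun_prop) (by fun_prop)

theorem measurable_state (h : IsDynamicalBitData P p k ξ N) (i : Fin k) (t : ℝ≥0) :
    Measurable fun ω => ξ i (N i t ω) ω :=
  (measurable_from_prod_countable_left (f := fun a : Ω × ℕ => ξ i a.2 a.1)
    fun n => h.bit_measurable i n).comp (measurable_id.prodMk ((h.clock_poisson i).measurable t))

theorem measureReal_state_eq_one_and [IsProbabilityMeasure P] (h : IsDynamicalBitData P p k ξ N) (i : Fin k) {s t : ℝ≥0}
    (hst : s ≤ t) : P.real {ω | ξ i (N i s ω) ω = 1 ∧ ξ i (N i t ω) ω = 1}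
      = p ^ 2 + p * (1 - p) * Real.exp (-((t : ℝ) - s)) := by
  have hN := (h.clock_poisson i).measurable
  rw [← (h.clock_poisson i).measureReal_eq_eq_exp hst]
  refine measureReal_random_index_eq_one (h.bit_measurable i) (hN s) (hN t) (h.bit_one i)
    (h.bits_indep.precomp (g := fun j => (i, j)) fun a b hab => (Prod.mk.inj hab).2) ?_
  exact (h.indepFun_coordinate i).comp (φ := id) (ψ := fun f : ℝ≥0 → ℕ => (f s, f t))
    measurable_id (by fun_prop)

theorem measureReal_state_eq_one [IsProbabilityMeasure P] (h : IsDynamicalBitData P p k ξ N) (i : Fin k) (t : ℝ≥0) :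
    P.real {ω | ξ i (N i t ω) ω = 1} = p := by
  have := h.measureReal_state_eq_one_and i (le_refl t)
  simp only [and_self, sub_self, neg_zero, Real.exp_zero] at this
  rw [this]
  ring

end IsDynamicalBitData

/-! ### Packings of the time set and a second moment bound -/

theorem floor_div_injective_of_separated {ι : Type*} {ε : ℝ} (hε : 0 < ε) {t : ι → ℝ≥0}
    (ht : ∀ i j, i ≠ j → ε ≤ dist (t i) (t j)) :
    Function.Injective fun i => ⌊(t i : ℝ) / ε⌋ := by
  intro i j hij
  by_contra hne
  have h1 := Int.abs_sub_lt_one_of_floor_eq_floor hij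
  have h2 := ht i j hne
  rw [NNReal.dist_eq] at h2
  rw [← sub_div, abs_div, abs_of_pos hε, div_lt_one hε] at h1
  linarith

theorem summable_exp_neg_mul_abs_int {c : ℝ} (hc : 0 < c) :
    Summable fun n : ℤ => Real.exp (-c * |(n : ℝ)|) := by
  have h : Summable fun n : ℕ => Real.exp (-c * n) := by
    have := Real.summable_exp_nat_mul_iff.2 (neg_lt_zero.2 hc)
    simpa [mul_comm] using this
  refine Summable.of_nat_of_neg ?_ ?_ <;> simpa using h

theorem tsum_exp_neg_mul_abs_int_pos {c : ℝ} (hc : 0 < c) :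
    0 < ∑' n : ℤ, Real.exp (-c * |(n : ℝ)|) :=
  (summable_exp_neg_mul_abs_int hc).tsum_pos (fun _ => (Real.exp_pos _).le) 0 (Real.exp_pos _)

/-- Separated points occupy distinct cells of length `ε`. Differences of cell indices exceed scaled
distances by at most `1`, hence the factor `exp c`. -/
theorem sum_exp_neg_dist_le_of_separated {ι : Type*} [Fintype ι] {ε c : ℝ} (hε : 0 < ε)
    (hc : 0 < c) {t : ι → ℝ≥0} (ht : ∀ i j, i ≠ j → ε ≤ dist (t i) (t j)) (i : ι) :
    ∑ j, Real.exp (-c * (dist (t i) (t j) / ε))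
      ≤ Real.exp c * ∑' n : ℤ, Real.exp (-c * |(n : ℝ)|) := by
  let n : ι → ℤ := fun j => ⌊(t i : ℝ) / ε⌋ - ⌊(t j : ℝ) / ε⌋
  have hn : Function.Injective n := fun j j' h =>
    floor_div_injective_of_separated hε ht (sub_right_injective h)
  calc ∑ j, Real.exp (-c * (dist (t i) (t j) / ε))
      ≤ ∑ j, Real.exp c * Real.exp (-c * |(n j : ℝ)|) := by
        refine Finset.sum_le_sum fun j _ => ?_
        rw [← Real.exp_add, Real.exp_le_exp]
        have habs : |(n j : ℝ)| ≤ dist (t i) (t j) / ε + 1 := by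
          rw [NNReal.dist_eq]
          have h1 := Int.floor_le ((t i : ℝ) / ε)
          have h2 := Int.lt_floor_add_one ((t i : ℝ) / ε)
          have h3 := Int.floor_le ((t j : ℝ) / ε)
          have h4 := Int.lt_floor_add_one ((t j : ℝ) / ε)
          have h5 : |(t i : ℝ) - t j| / ε = |(t i : ℝ) / ε - t j / ε| := by
            rw [← sub_div, abs_div, abs_of_pos hε]
          have h6 := neg_abs_le ((t i : ℝ) / ε - t j / ε)
          have h7 := le_abs_self ((t i : ℝ) / ε - t j / ε)
          rw [h5, abs_le]
          push_cast [n]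
          constructor <;> linarith
        nlinarith
    _ = Real.exp c * ∑ m ∈ Finset.univ.map ⟨n, hn⟩, Real.exp (-c * |(m : ℝ)|) := by
        rw [Finset.sum_map, Finset.mul_sum]
        rfl
    _ ≤ _ := by
        gcongr
        exact (summable_exp_neg_mul_abs_int hc).sum_le_tsum _ fun _ _ => (Real.exp_pos _).le

/-- Without boundedness the `sSup` in `ℕ` would default to `0`. -/
theorem bddAbove_card_separated {F : Set ℝ≥0} (hF : IsCompact F) {ε : ℝ} (hε : 0 < ε) :
    BddAbove {m : ℕ | 1 ≤ m ∧ ∃ t : Fin m → ℝ≥0, (∀ i, t i ∈ F) ∧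
      ∀ i j, i ≠ j → ε ≤ dist (t i) (t j)} := by
  obtain ⟨T, hT⟩ := hF.bddAbove
  refine ⟨(Finset.Icc 0 ⌊(T : ℝ) / ε⌋).card, ?_⟩
  rintro m ⟨-, t, htF, ht⟩
  rw [← Fintype.card_fin m, ← Finset.card_univ]
  refine Finset.card_le_card_of_injOn _ (fun i _ => ?_)
    (floor_div_injective_of_separated hε ht).injOn
  simp only [Finset.coe_Icc, Set.mem_Icc]
  refine ⟨Int.floor_nonneg.2 (by positivity), Int.floor_le_floor ?_⟩
  have : (t i : ℝ) ≤ T := hT (htF i)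
  gcongr

/-- A packing of maximal cardinality is an `ε`-net. -/
theorem exists_separated_net {F : Set ℝ≥0} (hF : IsCompact F) {ε : ℝ} (hε : 0 < ε) :
    ∃ t : Fin (kolmogorovCapacity F ε) → ℝ≥0, (∀ i, t i ∈ F) ∧
      (∀ i j, i ≠ j → ε ≤ dist (t i) (t j)) ∧ ∀ s ∈ F, ∃ i, dist s (t i) < ε := by
  have hbdd := bddAbove_card_separated hF hε
  rcases F.eq_empty_or_nonempty with rfl | ⟨x, hx⟩
  · have h0 : kolmogorovCapacity ∅ ε = 0 := by
      refine (congrArg sSup (Set.eq_empty_of_forall_notMem ?_)).trans csSup_empty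
      rintro m ⟨hm, t, ht, -⟩
      exact absurd (ht ⟨0, hm⟩) (Set.notMem_empty _)
    rw [h0]
    exact ⟨Fin.elim0, fun i => i.elim0, fun i => i.elim0, fun s hs => absurd hs (Set.notMem_empty s)⟩
  have hne : {m : ℕ | 1 ≤ m ∧ ∃ t : Fin m → ℝ≥0, (∀ i, t i ∈ F) ∧
      ∀ i j, i ≠ j → ε ≤ dist (t i) (t j)}.Nonempty :=
    ⟨1, le_rfl, fun _ => x, fun _ => hx, fun i j h => absurd (Subsingleton.elim i j) h⟩
  obtain ⟨-, t, htF, ht⟩ := Nat.sSup_mem hne hbdd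
  refine ⟨t, htF, ht, fun s hs => ?_⟩
  by_contra! hfar
  -- A point far from the whole packing would enlarge it.
  have hmem : kolmogorovCapacity F ε + 1 ∈ {m : ℕ | 1 ≤ m ∧ ∃ t : Fin m → ℝ≥0,
      (∀ i, t i ∈ F) ∧ ∀ i j, i ≠ j → ε ≤ dist (t i) (t j)} := by
    refine ⟨Nat.le_add_left _ _, Fin.cons s t, ?_, ?_⟩
    · exact Fin.cases hs htF
    · refine Fin.cases (Fin.cases (fun h => absurd rfl h) fun j _ => ?_)
        fun i => Fin.cases (fun _ => ?_) fun j h => ?_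
      · exact hfar j
      · exact (hfar i).trans_eq (dist_comm _ _)
      · exact ht i j fun h' => h (h' ▸ rfl)
  exact absurd (le_csSup hbdd hmem) (Nat.not_succ_le_self _)

/-- A second moment lower bound for the probability of a union. -/
theorem le_measureReal_iUnion_of_sum_inter_le {Ω ι : Type*} [MeasurableSpace Ω] [Fintype ι]
    {P : Measure Ω} [IsProbabilityMeasure P] {A : ι → Set Ω} (mA : ∀ i, MeasurableSet (A i))
    {a b : ℝ} (ha : 0 ≤ a) (hb : 0 < b) (hle : ∀ i, a ≤ P.real (A i))
    (hsum : ∀ i, ∑ j, P.real (A i ∩ A j) ≤ b) :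
    Fintype.card ι * (a ^ 2 / b) ≤ P.real (⋃ i, A i) := by
  -- With `X` the number of occurring events, `2rX - r²X²` is at most the indicator of the union; `r
  -- = a / b` maximizes `2ra - r²b`.
  set r := a / b
  have hr : 0 ≤ r := by positivity
  have hpt : ∀ ω, 2 * r * ∑ i, (A i).indicator (1 : Ω → ℝ) ω
      - r ^ 2 * ∑ i, ∑ j, (A i ∩ A j).indicator (1 : Ω → ℝ) ω
        ≤ (⋃ i, A i).indicator (1 : Ω → ℝ) ω := by
    intro ω
    have hsq : ∑ i, ∑ j, (A i ∩ A j).indicator (1 : Ω → ℝ) ω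
        = (∑ i, (A i).indicator (1 : Ω → ℝ) ω) ^ 2 := by
      rw [sq, Finset.sum_mul_sum]
      simp only [Set.inter_indicator_one, Pi.mul_apply]
    rw [hsq]
    by_cases hω : ω ∈ ⋃ i, A i
    · rw [Set.indicator_of_mem hω, Pi.one_apply]
      nlinarith [sq_nonneg (1 - r * ∑ i, (A i).indicator (1 : Ω → ℝ) ω)]
    · have h0 : ∑ i, (A i).indicator (1 : Ω → ℝ) ω = 0 :=
        Finset.sum_eq_zero fun i _ =>
          Set.indicator_of_notMem (fun hi => hω (Set.mem_iUnion.2 ⟨i, hi⟩)) _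
      rw [Set.indicator_of_notMem hω, h0]
      simp
  have hint : ∀ {s : Set Ω}, MeasurableSet s → Integrable (s.indicator (1 : Ω → ℝ)) P :=
    fun hs => (integrable_const 1).indicator hs
  have hI1 : Integrable (fun ω => 2 * r * ∑ i, (A i).indicator (1 : Ω → ℝ) ω) P :=
    (integrable_finsetSum _ fun i _ => hint (mA i)).const_mul _
  have hI2 : Integrable
      (fun ω => r ^ 2 * ∑ i, ∑ j, (A i ∩ A j).indicator (1 : Ω → ℝ) ω) P :=
    (integrable_finsetSum _ fun i _ => integrable_finsetSum _ fun j _ =>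
      hint ((mA i).inter (mA j))).const_mul _
  have h := integral_mono (hI1.sub hI2) (hint (MeasurableSet.iUnion mA)) hpt
  rw [integral_sub' hI1 hI2, integral_const_mul, integral_const_mul,
    integral_finsetSum _ (fun i _ => hint (mA i)),
    integral_finsetSum _ (fun i _ => integrable_finsetSum _ fun j _ =>
      hint ((mA i).inter (mA j))), integral_indicator_one (MeasurableSet.iUnion mA)] at h
  simp_rw [integral_finsetSum _ fun j _ => hint ((mA _).inter (mA j)),
    integral_indicator_one (mA _), integral_indicator_one ((mA _).inter (mA _))] at h
  have h1 : Fintype.card ι * a ≤ ∑ i, P.real (A i) := by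
    simpa using Finset.card_nsmul_le_sum Finset.univ _ _ fun i _ => hle i
  have h2 : ∑ i, ∑ j, P.real (A i ∩ A j) ≤ Fintype.card ι * b := by
    simpa using Finset.sum_le_card_nsmul Finset.univ _ _ fun i _ => hsum i
  calc Fintype.card ι * (a ^ 2 / b)
      = 2 * r * (Fintype.card ι * a) - r ^ 2 * (Fintype.card ι * b) := by
        simp only [r]
        field_simp
        ring
    _ ≤ 2 * r * ∑ i, P.real (A i) - r ^ 2 * ∑ i, ∑ j, P.real (A i ∩ A j) := by gcongr
    _ ≤ _ := h

/-! ### Counting ones among independent coordinates -/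

section Counting

variable {Ω ι : Type*} [MeasurableSpace Ω] [Fintype ι] {P : Measure Ω}

theorem measureReal_card_eq_one_eq [DecidableEq ι] [IsProbabilityMeasure P] {p : ℝ} {Y : ι → Ω → ℕ}
    (mY : ∀ i, Measurable (Y i)) (hY : iIndepFun Y P) (hp : ∀ i, P.real {ω | Y i ω = 1} = p)
    (n : ℕ) : P.real {ω | (Finset.univ.filter fun i => Y i ω = 1).card = n}
      = (Fintype.card ι).choose n * (p ^ n * (1 - p) ^ (Fintype.card ι - n)) := by
  let E : Finset ι → Set Ω := fun U => ⋂ i, Y i ⁻¹' (if i ∈ U then {1} else {1}ᶜ)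
  have hE : ∀ U ω, ω ∈ E U ↔ (Finset.univ.filter fun i => Y i ω = 1) = U := by
    intro U ω
    simp only [E, Set.mem_iInter, Set.mem_preimage, Finset.ext_iff, Finset.mem_filter,
      Finset.mem_univ, true_and]
    refine forall_congr' fun i => ?_
    by_cases hi : i ∈ U <;> simp [hi]
  have mE : ∀ U, MeasurableSet (E U) := fun U =>
    MeasurableSet.iInter fun i => mY i MeasurableSet.of_discrete
  have hPE : ∀ U, P.real (E U) = p ^ U.card * (1 - p) ^ (Fintype.card ι - U.card) := by
    intro U
    have := hY.measure_inter_preimage_eq_mul Finset.univ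
      (sets := fun i => if i ∈ U then {1} else {1}ᶜ) fun i _ => MeasurableSet.of_discrete
    simp only [Finset.mem_univ, Set.iInter_true] at this
    rw [measureReal_def, this, ENNReal.toReal_prod]
    have hi : ∀ i, (P (Y i ⁻¹' if i ∈ U then {1} else {1}ᶜ)).toReal
        = if i ∈ U then p else 1 - p := by
      intro i
      split_ifs with hiU
      · exact hp i
      · rw [← measureReal_def, Set.preimage_compl,
          measureReal_compl (mY i (measurableSet_singleton 1)), probReal_univ]
        exact congrArg (1 - ·) (hp i)
    simp_rw [hi]
    rw [Finset.prod_ite, Finset.prod_const, Finset.prod_const, Finset.filter_mem_eq_inter,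
      Finset.univ_inter, Finset.filter_not, Finset.filter_mem_eq_inter, Finset.univ_inter,
      Finset.card_univ_sdiff]
  have hunion : {ω | (Finset.univ.filter fun i => Y i ω = 1).card = n}
      = ⋃ U ∈ Finset.powersetCard n Finset.univ, E U := by
    ext ω
    simp [hE]
  rw [hunion, measureReal_biUnion_finset ?_ fun U _ => mE U,
    Finset.sum_congr rfl fun U hU => by rw [hPE, (Finset.mem_powersetCard.1 hU).2],
    Finset.sum_const, Finset.card_powersetCard, Finset.card_univ, nsmul_eq_mul]
  intro U _ U' _ hne
  rw [Function.onFun, Set.disjoint_left]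
  intro ω h h'
  exact hne (((hE U ω).1 h).symm.trans ((hE U' ω).1 h'))

theorem measureReal_exists_card_forall_mem_le [IsProbabilityMeasure P] {E : Type*}
    [MeasurableSpace E] {V : ι → Ω → E} (hV : iIndepFun V P) {B : Set E} (mB : MeasurableSet B)
    {q : ℝ} (hq : ∀ i, P.real (V i ⁻¹' B) ≤ q) (n : ℕ) :
    P.real {ω | ∃ U : Finset ι, U.card = n ∧ ∀ i ∈ U, V i ω ∈ B}
      ≤ (Fintype.card ι).choose n * q ^ n := by
  have hunion : {ω | ∃ U : Finset ι, U.card = n ∧ ∀ i ∈ U, V i ω ∈ B}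
      = ⋃ U ∈ Finset.powersetCard n Finset.univ, ⋂ i ∈ U, V i ⁻¹' B := by
    ext ω
    simp
  rw [hunion]
  refine (measureReal_biUnion_finset_le _ _).trans ?_
  calc ∑ U ∈ Finset.powersetCard n Finset.univ, P.real (⋂ i ∈ U, V i ⁻¹' B)
      ≤ ∑ U ∈ Finset.powersetCard n (Finset.univ : Finset ι), q ^ n := by
        refine Finset.sum_le_sum fun U hU => ?_
        rw [measureReal_def, hV.measure_inter_preimage_eq_mul U fun i _ => mB,
          ENNReal.toReal_prod, ← (Finset.mem_powersetCard.1 hU).2]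
        exact (Finset.prod_le_prod (fun i _ => ENNReal.toReal_nonneg) fun i _ => hq i).trans_eq
          (Finset.prod_const _)
    _ = _ := by simp

/-- An exponential Markov bound for the joint law of two counts. -/
theorem measureReal_card_eq_one_and_le [DecidableEq ι] [IsProbabilityMeasure P] {p r z : ℝ} (hz : 0 < z)
    {Y Y' : ι → Ω → ℕ} (mY : ∀ i, Measurable (Y i)) (mY' : ∀ i, Measurable (Y' i))
    (hind : iIndepFun (fun i ω => (Y i ω, Y' i ω)) P) (hp : ∀ i, P.real {ω | Y i ω = 1} = p)
    (hp' : ∀ i, P.real {ω | Y' i ω = 1} = p)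
    (hr : ∀ i, P.real {ω | Y i ω = 1 ∧ Y' i ω = 1} = r) {ℓ : ℕ} (hℓ : ℓ ≤ Fintype.card ι) :
    z ^ (2 * ℓ) * P.real {ω | (Finset.univ.filter fun i => Y i ω = 1).card = Fintype.card ι - ℓ ∧
        (Finset.univ.filter fun i => Y' i ω = 1).card = Fintype.card ι - ℓ}
      ≤ (z ^ 2 + 2 * z * (1 - z) * p + (1 - z) ^ 2 * r) ^ Fintype.card ι := by
  -- The product of these weights is `z ^ ℓ` when exactly `ℓ` coordinates differ from `1`.
  let f : ℕ → ℝ := fun a => if a = 1 then 1 else z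
  let g : ℕ × ℕ → ℝ := fun a => f a.1 * f a.2
  have hf0 : ∀ a, 0 ≤ f a := fun a => by simp only [f]; split_ifs <;> positivity
  have hfB : ∀ a, |f a| ≤ 1 + z := fun a => by
    rw [abs_of_nonneg (hf0 a)]
    simp only [f]; split_ifs <;> linarith
  have hprod : ∀ y : ι → ℕ, (Finset.univ.filter fun i => y i = 1).card = Fintype.card ι - ℓ →
      ∏ i, f (y i) = z ^ ℓ := by
    intro y hy
    simp only [f]
    rw [Finset.prod_ite, Finset.prod_const_one, one_mul, Finset.prod_const, Finset.filter_not,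
      Finset.card_univ_sdiff, hy]
    congr 1
    omega
  set S := {ω | (Finset.univ.filter fun i => Y i ω = 1).card = Fintype.card ι - ℓ ∧
        (Finset.univ.filter fun i => Y' i ω = 1).card = Fintype.card ι - ℓ}
  have mcard : ∀ {X : ι → Ω → ℕ}, (∀ i, Measurable (X i)) →
      MeasurableSet {ω | (Finset.univ.filter fun i => X i ω = 1).card = Fintype.card ι - ℓ} :=
    fun {X} mX => (measurable_pi_iff.2 mX)
      (t := {y : ι → ℕ | (Finset.univ.filter fun i => y i = 1).card = Fintype.card ι - ℓ})
      MeasurableSet.of_discrete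
  have mS : MeasurableSet S := (mcard mY).inter (mcard mY')
  have mg : ∀ i, Measurable fun ω => g (Y i ω, Y' i ω) := fun i =>
    (measurable_of_countable g).comp ((mY i).prodMk (mY' i))
  have hpt : ∀ ω, S.indicator (fun _ => z ^ (2 * ℓ)) ω ≤ ∏ i, g (Y i ω, Y' i ω) := by
    intro ω
    by_cases hω : ω ∈ S
    · rw [Set.indicator_of_mem hω]
      simp only [g]
      rw [Finset.prod_mul_distrib, hprod _ hω.1, hprod _ hω.2, two_mul, pow_add]
    · rw [Set.indicator_of_notMem hω]
      exact Finset.prod_nonneg fun i _ => mul_nonneg (hf0 _) (hf0 _)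
  have hbound : ∀ ω, ‖∏ i, g (Y i ω, Y' i ω)‖ ≤ ((1 + z) * (1 + z)) ^ Fintype.card ι := by
    intro ω
    rw [Real.norm_eq_abs, Finset.abs_prod, ← Finset.card_univ]
    refine (Finset.prod_le_prod (fun i _ => abs_nonneg _) fun i _ => ?_).trans_eq
      (Finset.prod_const _)
    rw [abs_mul]
    exact mul_le_mul (hfB _) (hfB _) (abs_nonneg _) (by positivity)
  have h := integral_mono ((integrable_const (μ := P) (z ^ (2 * ℓ))).indicator mS)
    (Integrable.of_bound (Finset.measurable_fun_prod _ fun i _ => mg i).aestronglyMeasurable _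
      (Eventually.of_forall hbound)) hpt
  rw [integral_indicator_const _ mS, smul_eq_mul, mul_comm,
    hind.integral_fun_prod_comp (f := fun _ => g)
      (fun i => ((mY i).prodMk (mY' i)).aemeasurable)
      (fun i => (measurable_of_countable g).aestronglyMeasurable)] at h
  refine h.trans_eq ?_
  rw [← Finset.card_univ, ← Finset.prod_const]
  refine Finset.prod_congr rfl fun i _ => ?_
  have m1 : MeasurableSet {ω | Y i ω = 1} := mY i (measurableSet_singleton 1)
  have m2 : MeasurableSet {ω | Y' i ω = 1} := mY' i (measurableSet_singleton 1)
  have m3 : MeasurableSet {ω | Y i ω = 1 ∧ Y' i ω = 1} := m1.inter m2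
  -- Each weight is `z + (1 - z)` times the indicator of a one, so only `p` and `r` enter the
  -- expectation.
  have hexp : ∀ ω, g (Y i ω, Y' i ω) = z ^ 2
      + z * (1 - z) * {ω | Y i ω = 1}.indicator (1 : Ω → ℝ) ω
      + z * (1 - z) * {ω | Y' i ω = 1}.indicator (1 : Ω → ℝ) ω
      + (1 - z) ^ 2 * {ω | Y i ω = 1 ∧ Y' i ω = 1}.indicator (1 : Ω → ℝ) ω := by
    intro ω
    by_cases h1 : Y i ω = 1 <;> by_cases h2 : Y' i ω = 1 <;> simp [g, f, h1, h2] <;> ring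
  have hint : ∀ {s : Set Ω} (c : ℝ), MeasurableSet s →
      Integrable (fun ω => c * s.indicator (1 : Ω → ℝ) ω) P :=
    fun c hs => ((integrable_const 1).indicator hs).const_mul c
  have hI1 : Integrable (fun ω => z ^ 2
      + z * (1 - z) * {ω | Y i ω = 1}.indicator (1 : Ω → ℝ) ω) P :=
    (integrable_const _).add (hint _ m1)
  have hI2 : Integrable (fun ω => z ^ 2
      + z * (1 - z) * {ω | Y i ω = 1}.indicator (1 : Ω → ℝ) ω
      + z * (1 - z) * {ω | Y' i ω = 1}.indicator (1 : Ω → ℝ) ω) P :=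
    hI1.add (hint _ m2)
  simp_rw [hexp]
  rw [integral_add hI2 (hint _ m3), integral_add hI1 (hint _ m2),
    integral_add (integrable_const _) (hint _ m1), integral_const_mul, integral_const_mul,
    integral_const_mul, integral_indicator_one m1, integral_indicator_one m2,
    integral_indicator_one m3, hp, hp', hr]
  simp
  ring

end Counting

/-- The number of coordinates whose state at time `t` is `1`. -/
def onesCount {Ω : Type*} {k : ℕ} (ξ : Fin k → ℕ → Ω → ℕ) (N : Fin k → ℝ≥0 → Ω → ℕ) (t : ℝ≥0)
    (ω : Ω) : ℕ :=
  (Finset.univ.filter fun i => ξ i (N i t ω) ω = 1).card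

theorem measurable_eval_clock (t : ℝ≥0) :
    Measurable fun a : (ℕ → ℕ) × (ℝ≥0 → ℕ) => a.1 (a.2 t) :=
  (measurable_from_prod_countable_left (f := fun b : (ℕ → ℕ) × ℕ => b.1 b.2)
    fun n => measurable_pi_apply n).comp
      (measurable_fst.prodMk ((measurable_pi_apply t).comp measurable_snd))

/-! ### One-time, two-time and interval probabilities -/

namespace IsDynamicalBitData

variable {Ω : Type*} [MeasurableSpace Ω] {P : Measure Ω} {p : ℝ} {k : ℕ}
  {ξ : Fin k → ℕ → Ω → ℕ} {N : Fin k → ℝ≥0 → Ω → ℕ}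

theorem ae_dynamicalSum_eq_onesCount [IsProbabilityMeasure P] (h : IsDynamicalBitData P p k ξ N) :
    ∀ᵐ ω ∂P, ∀ t, dynamicalSum ξ N t ω = onesCount ξ N t ω := by
  filter_upwards [h.ae_dynamicalSum_eq, h.ae_bit_eq_zero_or_one] with ω hω hbit t
  rw [hω, onesCount, Finset.card_filter]
  refine Finset.sum_congr rfl fun i _ => ?_
  rcases hbit i (N i t ω) with h' | h' <;> simp [h']

theorem measurableSet_onesCount_eq (h : IsDynamicalBitData P p k ξ N) (t : ℝ≥0) (n : ℕ) :
    MeasurableSet {ω | onesCount ξ N t ω = n} :=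
  (measurable_pi_iff.2 fun i => h.measurable_state i t)
    (t := {y : Fin k → ℕ | (Finset.univ.filter fun i => y i = 1).card = n})
    MeasurableSet.of_discrete

theorem measureReal_onesCount_eq [IsProbabilityMeasure P] (h : IsDynamicalBitData P p k ξ N)
    (t : ℝ≥0) (n : ℕ) :
    P.real {ω | onesCount ξ N t ω = n} = k.choose n * (p ^ n * (1 - p) ^ (k - n)) := by
  have hind : iIndepFun (fun i ω => ξ i (N i t ω) ω) P :=
    h.iIndepFun_coordinates.comp (fun _ a => a.1 (a.2 t)) fun _ => measurable_eval_clock t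
  have := measureReal_card_eq_one_eq (fun i => h.measurable_state i t) hind
    (fun i => h.measureReal_state_eq_one i t) n
  rwa [Fintype.card_fin] at this

theorem measureReal_onesCount_eq_and_le [IsProbabilityMeasure P]
    (h : IsDynamicalBitData P p k ξ N) {z : ℝ} (hz : 0 < z) (s t : ℝ≥0) {ℓ : ℕ} (hℓ : ℓ ≤ k) :
    z ^ (2 * ℓ) * P.real ({ω | onesCount ξ N s ω = k - ℓ} ∩ {ω | onesCount ξ N t ω = k - ℓ})
      ≤ (z ^ 2 + 2 * z * (1 - z) * p
          + (1 - z) ^ 2 * (p ^ 2 + p * (1 - p) * Real.exp (-dist s t))) ^ k := by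
  wlog hst : s ≤ t generalizing s t
  · have := this t s (le_of_not_ge hst)
    rwa [Set.inter_comm, dist_comm]
  have hind : iIndepFun (fun i ω => (ξ i (N i s ω) ω, ξ i (N i t ω) ω)) P :=
    h.iIndepFun_coordinates.comp (fun _ a => (a.1 (a.2 s), a.1 (a.2 t)))
      fun _ => (measurable_eval_clock s).prodMk (measurable_eval_clock t)
  have hdist : dist s t = (t : ℝ) - s := by
    rw [NNReal.dist_eq, abs_sub_comm, abs_of_nonneg (sub_nonneg.2 (NNReal.coe_le_coe.2 hst))]
  have := measureReal_card_eq_one_and_le hz (fun i => h.measurable_state i s)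
    (fun i => h.measurable_state i t) hind (fun i => h.measureReal_state_eq_one i s)
    (fun i => h.measureReal_state_eq_one i t)
    (fun i => h.measureReal_state_eq_one_and i hst) (ℓ := ℓ) (by rwa [Fintype.card_fin])
  rw [Fintype.card_fin] at this
  rw [hdist]
  exact this

/-- A coordinate equal to `1` somewhere in the interval was `1` at time `s`, or its clock rang by
time `t`; this is the event `B`. -/
theorem measureReal_exists_mem_Icc_onesCount_eq_le [IsProbabilityMeasure P]
    (h : IsDynamicalBitData P p k ξ N) {s t : ℝ≥0} (hst : s ≤ t) (n : ℕ) :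
    P.real {ω | ∃ u ∈ Set.Icc s t, onesCount ξ N u ω = n}
      ≤ k.choose n * (p + ((t : ℝ) - s)) ^ n := by
  let B : Set ((ℕ → ℕ) × (ℝ≥0 → ℕ)) := {a | a.1 (a.2 s) = 1} ∪ {a | a.2 s = a.2 t}ᶜ
  have mclock : ∀ u : ℝ≥0, Measurable fun a : (ℕ → ℕ) × (ℝ≥0 → ℕ) => a.2 u := fun u =>
    (measurable_pi_apply u).comp measurable_snd
  have mB : MeasurableSet B := (measurable_eval_clock s (measurableSet_singleton 1)).union
    (measurableSet_eq_fun (mclock s) (mclock t)).compl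
  have hq : ∀ i, P.real ((fun ω => ((fun j => ξ i j ω), fun u => N i u ω)) ⁻¹' B)
      ≤ p + ((t : ℝ) - s) := by
    intro i
    have hNi := h.clock_poisson i
    calc _ ≤ P.real {ω | ξ i (N i s ω) ω = 1} + P.real {ω | N i s ω = N i t ω}ᶜ :=
          measureReal_union_le _ _
      _ = p + (1 - Real.exp (-((t : ℝ) - s))) := by
          rw [h.measureReal_state_eq_one,
            measureReal_compl (measurableSet_eq_fun (hNi.measurable s) (hNi.measurable t)),
            hNi.measureReal_eq_eq_exp hst, probReal_univ]
      _ ≤ _ := by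
          have := Real.add_one_le_exp (-((t : ℝ) - s))
          linarith
  have hle := measureReal_exists_card_forall_mem_le h.iIndepFun_coordinates mB hq n
  rw [Fintype.card_fin] at hle
  -- The event is an uncountable union over `u`; monotonicity of the outer measure avoids its
  -- measurability.
  refine le_trans (ENNReal.toReal_mono (by finiteness) (measure_mono_ae ?_)) hle
  have hmono : ∀ᵐ ω ∂P, ∀ i, Monotone fun t => N i t ω :=
    ae_all_iff.2 fun i => (h.clock_poisson i).ae_monotone
  filter_upwards [hmono] with ω hω
  rintro ⟨u, ⟨hsu, hut⟩, hu⟩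
  refine ⟨_, hu, fun i hi => ?_⟩
  rw [Finset.mem_filter] at hi
  by_cases hN : N i s ω = N i t ω
  · left
    have h1 : N i s ω ≤ N i u ω := hω i hsu
    have h2 : N i u ω ≤ N i t ω := hω i hut
    change ξ i (N i s ω) ω = 1
    rw [show N i s ω = N i u ω by omega]
    exact hi.2
  · exact Or.inr hN

end IsDynamicalBitData

/-! ### Numerical estimates -/

/-- With `u = 1 - exp (-d)` the left side is `p + (1-p)z² - (1-z)²p(1-p)u`, with no term linear in
`z` alone. Then `(1-z)² ≥ 1/2`, `u ≥ d/(1+T)` and `x + 1 ≤ exp x` conclude. -/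
theorem tilted_factor_le {p z d T : ℝ} (hp₀ : 0 < p) (hp₁ : p < 1) (hz₁ : z ≤ 1 / 4)
    (hd : 0 ≤ d) (hdT : d ≤ T) :
    z ^ 2 + 2 * z * (1 - z) * p + (1 - z) ^ 2 * (p ^ 2 + p * (1 - p) * Real.exp (-d))
      ≤ p * Real.exp (z ^ 2 / p - (1 - p) / (2 * (1 + T)) * d) := by
  have hexp : Real.exp (-d) ≤ 1 - d / (1 + T) := by
    have h1 : Real.exp (-d) ≤ (1 + d)⁻¹ := by
      rw [Real.exp_neg]
      refine inv_anti₀ (by linarith) ?_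
      linarith [Real.add_one_le_exp d]
    have h2 : (1 + d)⁻¹ = 1 - d / (1 + d) := by
      field_simp
      ring
    have h3 : d / (1 + T) ≤ d / (1 + d) := by gcongr
    linarith
  have hexp₀ := Real.exp_pos (-d)
  set u := 1 - Real.exp (-d) with hu
  have hu₀ : 0 ≤ u := by
    have : Real.exp (-d) ≤ 1 := Real.exp_le_one_iff.2 (by linarith)
    linarith
  have hmain : p * (z ^ 2 / p - (1 - p) / (2 * (1 + T)) * d + 1)
      ≤ p * Real.exp (z ^ 2 / p - (1 - p) / (2 * (1 + T)) * d) := by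
    gcongr
    exact Real.add_one_le_exp _
  refine le_trans ?_ hmain
  have he : Real.exp (-d) = 1 - u := by rw [hu]; ring
  have hsplit : p * (z ^ 2 / p - (1 - p) / (2 * (1 + T)) * d + 1)
      = z ^ 2 + p - p * (1 - p) / 2 * (d / (1 + T)) := by
    field_simp
    ring
  have hud : p * (1 - p) / 2 * (d / (1 + T)) ≤ p * (1 - p) / 2 * u := by
    have : 0 < 1 - p := by linarith
    gcongr
    linarith
  have hpu : 0 ≤ p * (1 - p) * u := by
    have : 0 ≤ 1 - p := by linarith
    positivity
  rw [hsplit, he]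
  have hpz : 0 ≤ p * z ^ 2 := by positivity
  nlinarith [mul_nonneg hpu (sub_nonneg.2 hz₁), mul_nonneg hpu (sq_nonneg z)]

/-- The factor `2 ^ ℓ` comes from `k + 1 - ℓ ≥ k / 2`. -/
theorem le_choose_mul_pow {p : ℝ} (hp₀ : 0 < p) (hp₁ : p < 1) {k ℓ : ℕ} (hk : 2 * ℓ ≤ k) :
    (1 - p) ^ ℓ / (2 ^ ℓ * ℓ.factorial) * ((k : ℝ) ^ ℓ * p ^ k)
      ≤ k.choose (k - ℓ) * (p ^ (k - ℓ) * (1 - p) ^ (k - (k - ℓ))) := by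
  have hle : ℓ ≤ k := by omega
  rw [Nat.choose_symm hle, Nat.sub_sub_self hle]
  have h1 : ((k + 1 - ℓ : ℕ) : ℝ) ^ ℓ / ℓ.factorial ≤ k.choose ℓ := Nat.pow_le_choose ℓ k
  have h2 : (k : ℝ) / 2 ≤ ((k + 1 - ℓ : ℕ) : ℝ) := by
    rw [div_le_iff₀ two_pos]
    exact_mod_cast (by omega : k ≤ (k + 1 - ℓ) * 2)
  have h3 : p ^ k ≤ p ^ (k - ℓ) := pow_le_pow_of_le_one hp₀.le hp₁.le (Nat.sub_le _ _)
  have h4 : 0 < 1 - p := by linarith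
  calc (1 - p) ^ ℓ / (2 ^ ℓ * ℓ.factorial) * ((k : ℝ) ^ ℓ * p ^ k)
      = ((k : ℝ) / 2) ^ ℓ / ℓ.factorial * (p ^ k * (1 - p) ^ ℓ) := by
        rw [div_pow]
        field_simp
    _ ≤ ((k + 1 - ℓ : ℕ) : ℝ) ^ ℓ / ℓ.factorial * (p ^ (k - ℓ) * (1 - p) ^ ℓ) := by gcongr
    _ ≤ _ := by gcongr

theorem choose_mul_pow_le {p : ℝ} (hp₀ : 0 < p) {k ℓ : ℕ} (hk : 0 < k)
    (hle : ℓ ≤ k) {x : ℝ} (hx : 0 ≤ x) (hxk : x ≤ 2 / k) :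
    k.choose (k - ℓ) * (p + x) ^ (k - ℓ)
      ≤ Real.exp (2 / p) / p ^ ℓ * ((k : ℝ) ^ ℓ * p ^ k) := by
  have hk' : (0 : ℝ) < k := Nat.cast_pos.2 hk
  have h1 : p + x ≤ p * Real.exp (2 / (p * k)) := by
    have h2 : p * (2 / (p * k) + 1) ≤ p * Real.exp (2 / (p * k)) := by
      gcongr
      exact Real.add_one_le_exp _
    have h3 : p * (2 / (p * k) + 1) = p + 2 / k := by
      field_simp
      ring
    linarith
  have h4 : (p + x) ^ (k - ℓ) ≤ p ^ (k - ℓ) * Real.exp (2 / p) := by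
    calc (p + x) ^ (k - ℓ) ≤ (p * Real.exp (2 / (p * k))) ^ (k - ℓ) := by gcongr
      _ = p ^ (k - ℓ) * Real.exp ((k - ℓ : ℕ) * (2 / (p * k))) := by
        rw [mul_pow, Real.exp_nat_mul]
      _ ≤ p ^ (k - ℓ) * Real.exp (k * (2 / (p * k))) := by
        gcongr
        exact Nat.sub_le _ _
      _ = _ := by
        congr 2
        field_simp
  have h5 : (k.choose (k - ℓ) : ℝ) ≤ (k : ℝ) ^ ℓ := by
    rw [Nat.choose_symm hle]
    exact_mod_cast Nat.choose_le_pow k ℓ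
  calc k.choose (k - ℓ) * (p + x) ^ (k - ℓ)
      ≤ (k : ℝ) ^ ℓ * (p ^ (k - ℓ) * Real.exp (2 / p)) := by gcongr
    _ = _ := by
      rw [← Nat.sub_add_cancel hle, pow_add p, Nat.add_sub_cancel]
      field_simp

/-! ### The two bounds and the theorem -/

namespace IsDynamicalBitData

variable {Ω : Type*} [MeasurableSpace Ω] {P : Measure Ω} {p : ℝ} {k : ℕ}
  {ξ : Fin k → ℕ → Ω → ℕ} {N : Fin k → ℝ≥0 → Ω → ℕ}

theorem measureReal_onesCount_inter_le [IsProbabilityMeasure P] (h : IsDynamicalBitData P p k ξ N)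
    (hp₀ : 0 < p) (hp₁ : p < 1) {ℓ : ℕ} (hk : 16 ≤ k) (hℓ : ℓ ≤ k) {s t T : ℝ≥0} (hs : s ≤ T)
    (ht : t ≤ T) :
    P.real ({ω | onesCount ξ N s ω = k - ℓ} ∩ {ω | onesCount ξ N t ω = k - ℓ})
      ≤ (k : ℝ) ^ ℓ * p ^ k * (Real.exp (1 / p)
        * Real.exp (-((1 - p) / (2 * (1 + (T : ℝ)))) * (dist s t / (1 / k)))) := by
  have hk₀ : (0 : ℝ) < k := by positivity
  -- This tilt makes `z ^ (-2ℓ) = k ^ ℓ`, while `exp (z² / p)` to the power `k` stays `exp (1 / p)`.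
  set z : ℝ := (√(k : ℝ))⁻¹ with hz
  have hz₀ : 0 < z := by positivity
  have hz₁ : z ≤ 1 / 4 := by
    rw [hz, one_div]
    refine inv_anti₀ (by norm_num) (Real.le_sqrt_of_sq_le ?_)
    have : (16 : ℝ) ≤ k := by exact_mod_cast hk
    linarith
  have hzsq : z ^ 2 = 1 / k := by rw [hz, inv_pow, Real.sq_sqrt hk₀.le, one_div]
  have hdT : dist s t ≤ T := by
    rw [NNReal.dist_eq, abs_le]
    have h1 : (s : ℝ) ≤ T := hs
    have h2 : (t : ℝ) ≤ T := ht
    constructor <;> linarith [s.coe_nonneg, t.coe_nonneg]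
  have hmarkov := h.measureReal_onesCount_eq_and_le hz₀ s t hℓ
  have hfac := tilted_factor_le hp₀ hp₁ hz₁ dist_nonneg hdT
  have hnonneg : 0 ≤ z ^ 2 + 2 * z * (1 - z) * p
      + (1 - z) ^ 2 * (p ^ 2 + p * (1 - p) * Real.exp (-dist s t)) := by
    have h1 : 0 ≤ 1 - p := by linarith
    have h2 : 0 ≤ 1 - z := by linarith
    positivity
  have hpow := hmarkov.trans (pow_le_pow_left₀ hnonneg hfac k)
  rw [pow_mul, hzsq, mul_pow, ← Real.exp_nat_mul, one_div, inv_pow, inv_mul_le_iff₀ (by positivity)]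
    at hpow
  refine hpow.trans_eq ?_
  rw [← Real.exp_add, mul_assoc]
  congr 3
  field_simp
  ring

theorem le_measureReal_exists_onesCount_eq [IsProbabilityMeasure P]
    (h : IsDynamicalBitData P p k ξ N) (hp₀ : 0 < p) (hp₁ : p < 1) {ℓ : ℕ} (hk : 16 ≤ k)
    (hℓ : 2 * ℓ ≤ k) {F : Set ℝ≥0} (hF : IsCompact F) {T : ℝ≥0} (hT : ∀ t ∈ F, t ≤ T) {c S : ℝ}
    (hc : c = (1 - p) / (2 * (1 + (T : ℝ))))
    (hS : S = Real.exp (1 / p) * (Real.exp c * ∑' n : ℤ, Real.exp (-c * |(n : ℝ)|))) :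
    ((1 - p) ^ ℓ / (2 ^ ℓ * ℓ.factorial)) ^ 2 / S
        * (kolmogorovCapacity F (1 / k) * (k : ℝ) ^ ℓ * p ^ k)
      ≤ P.real {ω | ∃ t ∈ F, onesCount ξ N t ω = k - ℓ} := by
  have hk₀ : (0 : ℝ) < k := by positivity
  have hp₂ : 0 < 1 - p := by linarith
  have hc₀ : 0 < c := by rw [hc]; positivity
  have hS₀ : 0 < S := by
    have := tsum_exp_neg_mul_abs_int_pos hc₀
    rw [hS]
    positivity
  obtain ⟨t, htF, ht, -⟩ := exists_separated_net hF (one_div_pos.2 hk₀)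
  have hsum : ∀ i, ∑ j, P.real
      ({ω | onesCount ξ N (t i) ω = k - ℓ} ∩ {ω | onesCount ξ N (t j) ω = k - ℓ})
        ≤ (k : ℝ) ^ ℓ * p ^ k * S := by
    intro i
    refine (Finset.sum_le_sum fun j _ => h.measureReal_onesCount_inter_le hp₀ hp₁ hk
      (by omega) (hT _ (htF i)) (hT _ (htF j))).trans ?_
    rw [← Finset.mul_sum, ← Finset.mul_sum, ← hc, hS]
    gcongr
    exact sum_exp_neg_dist_le_of_separated (one_div_pos.2 hk₀) hc₀ ht i
  have hle := le_measureReal_iUnion_of_sum_inter_le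
    (fun i => h.measurableSet_onesCount_eq (t i) (k - ℓ))
    (a := (1 - p) ^ ℓ / (2 ^ ℓ * ℓ.factorial) * ((k : ℝ) ^ ℓ * p ^ k)) (by positivity)
    (by positivity) (fun i => (le_choose_mul_pow hp₀ hp₁ hℓ).trans_eq
      (h.measureReal_onesCount_eq (t i) (k - ℓ)).symm) hsum
  rw [Fintype.card_fin] at hle
  calc _ = (kolmogorovCapacity F (1 / k) : ℝ)
        * (((1 - p) ^ ℓ / (2 ^ ℓ * ℓ.factorial) * ((k : ℝ) ^ ℓ * p ^ k)) ^ 2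
          / ((k : ℝ) ^ ℓ * p ^ k * S)) := by
        field_simp
    _ ≤ _ := hle
    _ ≤ _ := measureReal_mono (Set.iUnion_subset fun i ω hω => (⟨t i, htF i, hω⟩ :
        ∃ t ∈ F, onesCount ξ N t ω = k - ℓ))

theorem measureReal_exists_onesCount_eq_le [IsProbabilityMeasure P]
    (h : IsDynamicalBitData P p k ξ N) (hp₀ : 0 < p) {ℓ : ℕ} (hk : 0 < k) (hℓ : ℓ ≤ k)
    {F : Set ℝ≥0} (hF : IsCompact F) :
    P.real {ω | ∃ t ∈ F, onesCount ξ N t ω = k - ℓ}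
      ≤ Real.exp (2 / p) / p ^ ℓ * (kolmogorovCapacity F (1 / k) * (k : ℝ) ^ ℓ * p ^ k) := by
  have hk₀ : (0 : ℝ) < k := by positivity
  obtain ⟨t, -, -, hnet⟩ := exists_separated_net hF (one_div_pos.2 hk₀)
  -- Truncated subtraction `t i - δ` keeps the interval in `ℝ≥0`, with length at most `2δ`.
  let δ : ℝ≥0 := 1 / k
  have hδ : (δ : ℝ) = 1 / k := by simp [δ]
  have hcover : {ω | ∃ u ∈ F, onesCount ξ N u ω = k - ℓ}
      ⊆ ⋃ i, {ω | ∃ u ∈ Set.Icc (t i - δ) (t i + δ), onesCount ξ N u ω = k - ℓ} := by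
    rintro ω ⟨u, huF, hu⟩
    obtain ⟨i, hi⟩ := hnet u huF
    rw [NNReal.dist_eq, ← hδ, abs_lt] at hi
    refine Set.mem_iUnion.2 ⟨i, u, ⟨?_, ?_⟩, hu⟩
    · rw [tsub_le_iff_right, ← NNReal.coe_le_coe]
      push_cast
      linarith
    · rw [← NNReal.coe_le_coe]
      push_cast
      linarith
  calc _ ≤ ∑ i, P.real {ω | ∃ u ∈ Set.Icc (t i - δ) (t i + δ), onesCount ξ N u ω = k - ℓ} :=
        (measureReal_mono hcover).trans (measureReal_iUnion_fintype_le _)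
    _ ≤ ∑ i : Fin (kolmogorovCapacity F (1 / k)),
          Real.exp (2 / p) / p ^ ℓ * ((k : ℝ) ^ ℓ * p ^ k) := by
        refine Finset.sum_le_sum fun i _ => ?_
        have hle : t i - δ ≤ t i + δ := tsub_le_self.trans le_self_add
        refine (h.measureReal_exists_mem_Icc_onesCount_eq_le hle _).trans
          (choose_mul_pow_le hp₀ hk hℓ (sub_nonneg.2 (NNReal.coe_le_coe.2 hle)) ?_)
        have h1 : (t i : ℝ) ≤ ((t i - δ : ℝ≥0) : ℝ) + δ := by
          exact_mod_cast le_tsub_add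
        have h2 : (2 : ℝ) / k = δ + δ := by rw [hδ]; ring
        rw [h2]
        push_cast
        linarith
    _ = _ := by
        simp only [Finset.sum_const, Finset.card_univ, Fintype.card_fin, nsmul_eq_mul]
        ring

theorem measureReal_exists_dynamicalSum_eq [IsProbabilityMeasure P]
    (h : IsDynamicalBitData P p k ξ N) {ℓ : ℕ} (hℓ : ℓ ≤ k) (F : Set ℝ≥0) :
    P.real {ω | ∃ t ∈ F, (dynamicalSum ξ N t ω : ℤ) = (k : ℤ) - (ℓ : ℤ)}
      = P.real {ω | ∃ t ∈ F, onesCount ξ N t ω = k - ℓ} := by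
  refine measureReal_congr ?_
  filter_upwards [h.ae_dynamicalSum_eq_onesCount] with ω hω
  refine propext (exists_congr fun t => and_congr_right fun _ => ?_)
  rw [hω, ← Nat.cast_sub hℓ, Nat.cast_inj]

end IsDynamicalBitData

theorem theorem1p1 (p : ℝ) (hp₀ : 0 < p) (hp₁ : p < 1) (ℓ : ℕ) (hℓ : 1 ≤ ℓ)
    (F : Set ℝ≥0) (hF : IsCompact F) :
    ∃ c C : ℝ, 0 < c ∧ 0 < C ∧ ∀ᶠ k : ℕ in atTop,
      ∀ (Ω : Type*) [MeasurableSpace Ω] (P : Measure Ω) [IsProbabilityMeasure P]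
        (ξ : Fin k → ℕ → Ω → ℕ) (N : Fin k → ℝ≥0 → Ω → ℕ), IsDynamicalBitData P p k ξ N →
        c * (kolmogorovCapacity F (1 / k) * (k : ℝ) ^ ℓ * p ^ k)
            ≤ P.real {ω | ∃ t ∈ F, (dynamicalSum ξ N t ω : ℤ) = (k : ℤ) - (ℓ : ℤ)} ∧
          P.real {ω | ∃ t ∈ F, (dynamicalSum ξ N t ω : ℤ) = (k : ℤ) - (ℓ : ℤ)}
            ≤ C * (kolmogorovCapacity F (1 / k) * (k : ℝ) ^ ℓ * p ^ k) := by
  obtain ⟨T, hT⟩ := hF.bddAbove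
  have hp₂ : 0 < 1 - p := by linarith
  -- The decay rate uses the bound `T` on `F`: `1 - exp (-d)` is at least linear in `d` only on
  -- bounded ranges.
  let r : ℝ := (1 - p) / (2 * (1 + (T : ℝ)))
  let S : ℝ := Real.exp (1 / p) * (Real.exp r * ∑' n : ℤ, Real.exp (-r * |(n : ℝ)|))
  have hr₀ : 0 < r := by positivity
  have hS₀ : 0 < S := by
    have := tsum_exp_neg_mul_abs_int_pos hr₀
    positivity
  refine ⟨((1 - p) ^ ℓ / (2 ^ ℓ * ℓ.factorial)) ^ 2 / S, Real.exp (2 / p) / p ^ ℓ,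
    by positivity, by positivity, ?_⟩
  filter_upwards [eventually_ge_atTop 16, eventually_ge_atTop (2 * ℓ)]
    with k hk hk' Ω _ P _ ξ N h
  have hle : ℓ ≤ k := by omega
  rw [h.measureReal_exists_dynamicalSum_eq hle]
  exact ⟨h.le_measureReal_exists_onesCount_eq hp₀ hp₁ hk hk' hF hT rfl rfl,
    h.measureReal_exists_onesCount_eq_le hp₀ (by omega) hle hF⟩
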